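/- Let $G$ be a finite group. All representations are on finite-dimensional complex vector spaces, and $\sim$ denotes equivalence of representations. Let $\tau\colon G\to G$ be an involutory anti-automorphism, i.e. $\tau(gh)=\tau(h)\tau(g)$ and $\tau(\tau(g))=g$ for all $g,h\in G$. For a representation $(\rho,V)$ of $G$ let $\rho^\tau$ be the representation of $G$ on the dual space $V'$ given by $[\rho^\tau(g)f](v)=f(\rho(\tau(g))v)$ for $g\in G$, $f\in V'$, $v\in V$. For $\tau=\tau_{\mathrm{inv}}\colon g\mapsto g^{-1}$ this is the dual (conjugate) representation $\rho'$. A representation is multiplicity-free if it is a direct sum of finitely many pairwise inequivalent irreducible subrepresentations. The group $G$ is called $\tau$-simply reducible if (i) $\rho_1\otimes\rho_2$, with $g$ acting as $\rho_1(g)\otimes\rho_2(g)$, is multiplicity-free for all irreducible representations $\rho_1,\rho_2$ of $G$, and (ii) $\rho^\tau\sim\rho$ for every irreducible representation $\rho$ of $G$. It is called simply reducible if (i) holds and $\rho'\sim\rho$ for every irreducible representation $\rho$ of $G$. Let $\widetilde G^3=\{(g,g,g):g\in G\}\le G^3$ and $\tau_3(g_1,g_2,g_3)=(\tau(g_1),\tau(g_2),\tau(g_3))$.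 **Theorem (Mackey's criterion for $\tau$-simply reducible groups).** The group $G$ is $\tau$-simply reducible if and only if every double coset of $\widetilde G^3$ in $G^3$ is $\tau_3$-invariant, i.e. $\tau_3(\widetilde G^3x\widetilde G^3)=\widetilde G^3x\widetilde G^3$ for all $x\in G^3$. In particular, $G$ is simply reducible if and only if every double coset of $\widetilde G^3$ in $G^3$ is invariant under $(\tau_{\mathrm{inv}})_3\colon(g_1,g_2,g_3)\mapsto(g_1^{-1},g_2^{-1},g_3^{-1})$. -/

import Mathlib

universe u v w

/-- An involutory anti-automorphism of `G`: a map `τ : G → G` with `τ (g * h) = τ h * τ g` and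
`τ (τ g) = g` (in particular, a bijection). -/
structure InvolutoryAntiAut (G : Type u) [Group G] where
  toFun : G → G
  map_mul' : ∀ g h : G, toFun (g * h) = toFun h * toFun g
  involutive' : ∀ g : G, toFun (toFun g) = g

namespace InvolutoryAntiAut

instance instCoeFun (G : Type u) [Group G] : CoeFun (InvolutoryAntiAut G) fun _ => G → G :=
  ⟨InvolutoryAntiAut.toFun⟩

theorem map_mul {G : Type u} [Group G] (τ : InvolutoryAntiAut G) (g h : G) :
    τ (g * h) = τ h * τ g :=
  τ.map_mul' g h

theorem apply_apply {G : Type u} [Group G] (τ : InvolutoryAntiAut G) (g : G) : τ (τ g) = g :=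
  τ.involutive' g

theorem map_one {G : Type u} [Group G] (τ : InvolutoryAntiAut G) : τ 1 = 1 := by
  have h : τ 1 * τ 1 = τ 1 := by rw [← τ.map_mul, mul_one]
  exact mul_eq_left.mp h

/-- The inversion `g ↦ g⁻¹`. -/
def inversion (G : Type u) [Group G] : InvolutoryAntiAut G where
  toFun g := g⁻¹
  map_mul' := mul_inv_rev
  involutive' := inv_inv

/-- The componentwise extension of `τ` to the power `Gⁿ`. -/
def power {G : Type u} [Group G] (τ : InvolutoryAntiAut G) (n : ℕ) :
    InvolutoryAntiAut (Fin n → G) where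
  toFun x i := τ (x i)
  map_mul' x y := funext fun i => τ.map_mul (x i) (y i)
  involutive' x := funext fun i => τ.apply_apply (x i)

end InvolutoryAntiAut

/-- The diagonal subgroup `{(g, g, …, g) : g ∈ G}` of `Gⁿ`. -/
def diagonalSubgroup (G : Type u) [Group G] (n : ℕ) : Subgroup (Fin n → G) where
  carrier := {x | ∃ g : G, x = fun _ => g}
  mul_mem' := by
    rintro _ _ ⟨g, rfl⟩ ⟨h, rfl⟩
    exact ⟨g * h, rfl⟩
  one_mem' := ⟨1, rfl⟩
  inv_mem' := by
    rintro _ ⟨g, rfl⟩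
    exact ⟨g⁻¹, rfl⟩

/-- The `τ`-conjugate `ρ^τ` of `ρ`, acting on the dual space by `ρ^τ(g) = ρ(τ(g))ᵀ`, that is,
`(ρ^τ(g) f)(v) = f (ρ(τ(g)) v)`. -/
def Representation.tauConj {G : Type u} [Group G] {V : Type v} [AddCommGroup V] [Module ℂ V]
    (ρ : Representation ℂ G V) (τ : InvolutoryAntiAut G) :
    Representation ℂ G (Module.Dual ℂ V) where
  toFun g := Module.Dual.transpose (R := ℂ) (ρ (τ g))
  map_one' := by
    ext f v
    simp [τ.map_one, Module.Dual.transpose_apply]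
  map_mul' g h := by
    ext f v
    simp [τ.map_mul, Module.Dual.transpose_apply]

/-- A representation is multiplicity-free if it is an internal direct sum of finitely many
irreducible subrepresentations that are pairwise inequivalent. -/
def Representation.IsMultiplicityFree {G : Type u} [Group G] {V : Type v} [AddCommGroup V]
    [Module ℂ V] (ρ : Representation ℂ G V) : Prop :=
  ∃ (m : ℕ) (W : Fin m → Subrepresentation ρ),
    DirectSum.IsInternal (fun i => (W i).toSubmodule) ∧
    (∀ i, (W i).toRepresentation.IsIrreducible) ∧
    ∀ i j, i ≠ j → IsEmpty ((W i).toRepresentation.Equiv (W j).toRepresentation)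

/-- All Kronecker products `ρ₁ ⊗ ρ₂` of two irreducible finite-dimensional complex representations
of `G` are multiplicity-free. -/
def HasMultiplicityFreeKroneckerProducts (G : Type u) [Group G] : Prop :=
  ∀ (V₁ V₂ : Type w) [AddCommGroup V₁] [Module ℂ V₁] [FiniteDimensional ℂ V₁]
    [AddCommGroup V₂] [Module ℂ V₂] [FiniteDimensional ℂ V₂]
    (ρ₁ : Representation ℂ G V₁) (ρ₂ : Representation ℂ G V₂),
    ρ₁.IsIrreducible → ρ₂.IsIrreducible → (ρ₁.tprod ρ₂).IsMultiplicityFree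

/-- `G` is `τ`-simply reducible: Kronecker products of two irreducible representations are
multiplicity-free, and `ρ^τ ∼ ρ` for every irreducible `ρ`. -/
def IsTauSimplyReducible (G : Type u) [Group G] (τ : InvolutoryAntiAut G) : Prop :=
  HasMultiplicityFreeKroneckerProducts.{u, w} G ∧
  ∀ (V : Type w) [AddCommGroup V] [Module ℂ V] [FiniteDimensional ℂ V]
    (ρ : Representation ℂ G V), ρ.IsIrreducible → Nonempty ((ρ.tauConj τ).Equiv ρ)

/-- `G` is simply reducible: Kronecker products of two irreducible representations are
multiplicity-free, and every irreducible `ρ` is equivalent to its dual (conjugate)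
representation. -/
def IsSimplyReducible (G : Type u) [Group G] : Prop :=
  HasMultiplicityFreeKroneckerProducts.{u, w} G ∧
  ∀ (V : Type w) [AddCommGroup V] [Module ℂ V] [FiniteDimensional ℂ V]
    (ρ : Representation ℂ G V), ρ.IsIrreducible → Nonempty (ρ.dual.Equiv ρ)

/-- Every double coset `K x K` of the diagonal subgroup `K` in `Gⁿ` is invariant under the
componentwise extension `τₙ` of `τ` to `Gⁿ`, that is, `τₙ(K x K) = K x K`. -/
def DiagonalDoubleCosetsInvariant (G : Type u) [Group G] (τ : InvolutoryAntiAut G) (n : ℕ) :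
    Prop :=
  ∀ x : Fin n → G,
    (τ.power n : (Fin n → G) → (Fin n → G)) ''
        DoubleCoset.doubleCoset x (diagonalSubgroup G n) (diagonalSubgroup G n) =
      DoubleCoset.doubleCoset x (diagonalSubgroup G n) (diagonalSubgroup G n)

/-!
The double cosets of the diagonal in `G³` are the orbits of `G` on `G²` under simultaneous
conjugation, so they are all `τ₃`-invariant if and only if every pair `(g, h)` is simultaneously
conjugate to `(τ g, τ h)` (`diagonalDoubleCosetsInvariant_three_iff`). It remains to compare this
condition with `τ`-simple reducibility (`isTauSimplyReducible_iff`).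

Both directions rest on one bilinear form. Isomorphisms `ρᵢ^τ ≃ ρᵢ` are nondegenerate forms on `Vᵢ`
for which the adjoint of `ρᵢ(g)` is `ρᵢ(τ g)`; their product is a form `β` on `V₁ ⊗ V₂` for which the
adjoint of `ρ₁(g) ⊗ ρ₂(h)` is `ρ₁(τ g) ⊗ ρ₂(τ h)` (`Representation.exists_form_of_tauConj_equiv`).

Suppose that `(g, h)` and `(τ g, τ h)` are always simultaneously conjugate. Then `ρ^τ` and `ρ` have
the same character, so they are equivalent if `ρ` is irreducible
(`Representation.nonempty_tauConj_equiv`). By Burnside's theorem, the algebra of intertwining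
operators of `ρ₁ ⊗ ρ₂` is spanned by the averages of the operators `ρ₁(g) ⊗ ρ₂(h)` over
simultaneous conjugation. These averages are self-adjoint for `β`. An algebra of self-adjoint
operators is commutative, and therefore `ρ₁ ⊗ ρ₂` is multiplicity-free
(`Representation.isMultiplicityFree_tprod`).

Conversely, suppose that `G` is `τ`-simply reducible. The irreducible summands of `ρ₁ ⊗ ρ₂` are
pairwise inequivalent and isomorphic to their `τ`-conjugates, so by Schur's lemma they are mutually
orthogonal for `β`, and intertwining operators act on them as scalars. Hence every intertwining
operator is self-adjoint (`Representation.IsMultiplicityFree.form_intertwiningMap_comm`). Applied to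
the sum of the operators over all simultaneous conjugates of a pair, this shows that `(g, h)` and
`(τ g, τ h)` give the same operator on `V₁ ⊗ V₂` for all irreducible `ρ₁` and `ρ₂`
(`Representation.conjugationSum_tau_eq`). The regular representation is a sum of irreducible ones and
separates simultaneous conjugacy classes, so the two pairs are simultaneously conjugate.
-/

open scoped TensorProduct

/-! ### Double cosets of the diagonal -/

/-- Sending `x` to `(x₂⁻¹ x₀, x₂⁻¹ x₁)` identifies the double cosets of the diagonal in `G³` with
the orbits of `G` acting on `G²` by simultaneous conjugation; under this identification `τ₃` becomes
the componentwise action of `τ`. -/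
theorem diagonalDoubleCosetsInvariant_three_iff {G : Type u} [Group G]
    (τ : InvolutoryAntiAut G) :
    DiagonalDoubleCosetsInvariant G τ 3 ↔
      ∀ g h : G, ∃ k : G, τ g = k * g * k⁻¹ ∧ τ h = k * h * k⁻¹ := by
  constructor
  · intro H g h
    have hmem : τ.power 3 ![g, h, 1] ∈
        DoubleCoset.doubleCoset ![g, h, 1] (diagonalSubgroup G 3) (diagonalSubgroup G 3) := by
      rw [← H]
      exact ⟨_, DoubleCoset.mem_doubleCoset_self _ _ _, rfl⟩
    obtain ⟨_, ⟨a, rfl⟩, _, ⟨b, rfl⟩, e⟩ := DoubleCoset.mem_doubleCoset.mp hmem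
    have e0 : τ g = a * g * b := congrFun e 0
    have e1 : τ h = a * h * b := congrFun e 1
    have e2 : τ 1 = a * 1 * b := congrFun e 2
    rw [τ.map_one, mul_one] at e2
    obtain rfl : b = a⁻¹ := (inv_eq_of_mul_eq_one_right e2.symm).symm
    exact ⟨a, e0, e1⟩
  · intro H x
    have hsub : ∀ y ∈ DoubleCoset.doubleCoset x (diagonalSubgroup G 3) (diagonalSubgroup G 3),
        τ.power 3 y ∈
          DoubleCoset.doubleCoset x (diagonalSubgroup G 3) (diagonalSubgroup G 3) := by
      intro y hy
      obtain ⟨_, ⟨a, rfl⟩, _, ⟨b, rfl⟩, rfl⟩ := DoubleCoset.mem_doubleCoset.mp hy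
      obtain ⟨k, h0, h1⟩ := H ((x 2)⁻¹ * x 0) ((x 2)⁻¹ * x 1)
      -- The double coset of `x` is that of `(x₂⁻¹ x₀, x₂⁻¹ x₁, 1)`, to which `H` applies.
      have key : ∀ i, τ (x i) = k * (x 2)⁻¹ * x i * (k⁻¹ * τ (x 2)) := by
        intro i
        have hi : τ ((x 2)⁻¹ * x i) = k * ((x 2)⁻¹ * x i) * k⁻¹ := by
          fin_cases i
          · exact h0
          · exact h1
          · simp [τ.map_one]
        calc τ (x i) = τ (x 2 * ((x 2)⁻¹ * x i)) := by rw [mul_inv_cancel_left]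
          _ = _ := by rw [τ.map_mul, hi]; group
      refine DoubleCoset.mem_doubleCoset.mpr ⟨_, ⟨τ b * (k * (x 2)⁻¹), rfl⟩, _,
        ⟨k⁻¹ * τ (x 2) * τ a, rfl⟩, funext fun i => ?_⟩
      change τ (a * x i * b) = τ b * (k * (x 2)⁻¹) * x i * (k⁻¹ * τ (x 2) * τ a)
      rw [τ.map_mul, τ.map_mul, key i]
      group
    refine Set.Subset.antisymm ?_ fun y hy => ⟨_, hsub y hy, (τ.power 3).apply_apply y⟩
    rintro _ ⟨y, hy, rfl⟩
    exact hsub y hy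

namespace Representation

/-! ### Operators of irreducible representations -/

theorem IsIrreducible.nontrivial {G : Type u} [Group G] {V : Type v} [AddCommGroup V] [Module ℂ V]
    {ρ : Representation ℂ G V} (hρ : ρ.IsIrreducible) : Nontrivial V := by
  have := (irreducible_iff_isSimpleModule_asModule ρ).mp hρ
  exact IsSimpleModule.nontrivial (MonoidAlgebra ℂ G) ρ.asModule

/-- Schur's lemma in averaged form: `∑ g, ρ(g) A ρ(g)⁻¹` is the scalar `|G| tr(A) / dim V`. -/
theorem sum_conj_eq_smul_one {G : Type u} [Group G] [Fintype G] {V : Type v}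
    [AddCommGroup V] [Module ℂ V] [FiniteDimensional ℂ V] (ρ : Representation ℂ G V)
    (hρ : ρ.IsIrreducible) (A : Module.End ℂ V) :
    ∑ g : G, ρ g * A * ρ g⁻¹ =
      ((Fintype.card G : ℂ) * LinearMap.trace ℂ V A / Module.finrank ℂ V) • 1 := by
  obtain ⟨c, hc⟩ := (IsIrreducible.algebraMap_intertwiningMap_bijective_of_isAlgClosed (ρ := ρ)).2
    (LinearMap.intertwiningMap_of_isIntertwiningMap ρ ρ (∑ g : G, ρ g * A * ρ g⁻¹) (by
      intro h v
      simp only [LinearMap.sum_apply, map_sum, Module.End.mul_apply]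
      refine Fintype.sum_equiv (Equiv.mulLeft h⁻¹) _ _ fun g => ?_
      simp only [← Module.End.mul_apply, ← map_mul, Equiv.coe_mulLeft, mul_inv_rev,
        inv_inv]
      rw [← mul_assoc (ρ h), ← map_mul, mul_inv_cancel_left]))
  have hc' : ∑ g : G, ρ g * A * ρ g⁻¹ = c • (1 : Module.End ℂ V) := by
    ext v
    exact (congrArg (fun f : ρ.IntertwiningMap ρ => f v) hc).symm
  have := hρ.nontrivial
  have hn : (Module.finrank ℂ V : ℂ) ≠ 0 := by
    exact_mod_cast Module.finrank_pos.ne'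
  -- Comparing traces identifies the scalar given by Schur's lemma.
  have ht := congrArg (LinearMap.trace ℂ V) hc'
  have hconj : ∀ g : G, LinearMap.trace ℂ V (ρ g * A * ρ g⁻¹) = LinearMap.trace ℂ V A := by
    intro g
    rw [LinearMap.trace_mul_comm, ← mul_assoc, ← map_mul]
    simp
  simp only [map_sum, hconj, map_smul, LinearMap.trace_one, smul_eq_mul, Finset.sum_const,
    Finset.card_univ, nsmul_eq_mul] at ht
  rw [hc', ht, mul_div_cancel_right₀ _ hn]

/-- Burnside's theorem for finite groups: the operators of an irreducible representation span
`End V`. -/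
theorem span_range_eq_top_of_isIrreducible {G : Type u} [Group G] [Finite G] {V : Type v}
    [AddCommGroup V] [Module ℂ V] [FiniteDimensional ℂ V] (ρ : Representation ℂ G V)
    (hρ : ρ.IsIrreducible) : Submodule.span ℂ (Set.range ρ) = ⊤ := by
  have := Fintype.ofFinite G
  have := hρ.nontrivial
  have hn : (Module.finrank ℂ V : ℂ) ≠ 0 := by
    exact_mod_cast Module.finrank_pos.ne'
  have hG : (Fintype.card G : ℂ) ≠ 0 := by exact_mod_cast Fintype.card_ne_zero
  have hrank : ∀ (f : Module.Dual ℂ V) (w : V),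
      f.smulRight w ∈ Submodule.span ℂ (Set.range ρ) := by
    intro f w
    -- Read the average of `f.smulRight v`, applied to `w`, as a function of `v` instead of `w`.
    have key : ((Fintype.card G : ℂ) / Module.finrank ℂ V) • f.smulRight w =
        ∑ g : G, f (ρ g⁻¹ w) • ρ g := by
      ext v
      have h := congrArg (fun B : Module.End ℂ V => B w)
        (sum_conj_eq_smul_one ρ hρ (f.smulRight v))
      simp only [LinearMap.sum_apply, Module.End.mul_apply, LinearMap.smulRight_apply, map_smul,
        LinearMap.smul_apply, Module.End.one_apply, LinearMap.trace_smulRight] at h ⊢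
      rw [h, smul_smul]
      congr 1
      ring
    have hmem := Submodule.sum_mem (Submodule.span ℂ (Set.range ρ)) (t := Finset.univ)
      (f := fun g : G => f (ρ g⁻¹ w) • ρ g)
      fun g _ => Submodule.smul_mem _ _ (Submodule.subset_span ⟨g, rfl⟩)
    rw [← key] at hmem
    exact (Submodule.smul_mem_iff _ (div_ne_zero hG hn)).mp hmem
  rw [eq_top_iff]
  rintro A -
  obtain ⟨t, rfl⟩ := (dualTensorHomEquiv ℂ V V).surjective A
  induction t with
  | zero => simp
  | add x y hx hy => rw [map_add]; exact add_mem hx hy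
  | tmul f w =>
    convert hrank f w using 1
    ext v
    simp [dualTensorHomEquiv]

/-- The operators `ρ₁(g) ⊗ ρ₂(h)`, with independent `g` and `h`, span `End (V₁ ⊗ V₂)`. -/
theorem span_range_map_eq_top {G : Type u} [Group G] [Finite G]
    {V₁ V₂ : Type v} [AddCommGroup V₁] [Module ℂ V₁] [FiniteDimensional ℂ V₁]
    [AddCommGroup V₂] [Module ℂ V₂] [FiniteDimensional ℂ V₂]
    (ρ₁ : Representation ℂ G V₁) (ρ₂ : Representation ℂ G V₂)
    (h₁ : ρ₁.IsIrreducible) (h₂ : ρ₂.IsIrreducible) :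
    Submodule.span ℂ (Set.range fun x : G × G => TensorProduct.map (ρ₁ x.1) (ρ₂ x.2)) = ⊤ := by
  rw [eq_top_iff]
  rintro A -
  obtain ⟨t, rfl⟩ := (homTensorHomEquiv ℂ V₁ V₂ V₁ V₂).surjective A
  rw [homTensorHomEquiv_apply]
  induction t with
  | zero => simp
  | add x y hx hy => rw [map_add]; exact add_mem hx hy
  | tmul A B =>
    rw [TensorProduct.homTensorHomMap_apply]
    have hA : A ∈ Submodule.span ℂ (Set.range ρ₁) := by
      rw [span_range_eq_top_of_isIrreducible ρ₁ h₁]; trivial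
    have hB : B ∈ Submodule.span ℂ (Set.range ρ₂) := by
      rw [span_range_eq_top_of_isIrreducible ρ₂ h₂]; trivial
    have := Submodule.apply_mem_map₂ (TensorProduct.mapBilinear (.id ℂ) V₁ V₂ V₁ V₂) hA hB
    rw [Submodule.map₂_span_span] at this
    refine Submodule.span_mono ?_ this
    rintro _ ⟨_, ⟨g, rfl⟩, _, ⟨h, rfl⟩, rfl⟩
    exact ⟨(g, h), rfl⟩

/-! ### Decompositions into irreducible summands -/

/-- Maschke's theorem: a finite-dimensional representation of a finite group is an internal direct
sum of irreducible subrepresentations. -/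
theorem exists_isInternal_isIrreducible {G : Type u} [Group G] [Finite G] {V : Type v}
    [AddCommGroup V] [Module ℂ V] [FiniteDimensional ℂ V] (ρ : Representation ℂ G V) :
    ∃ (m : ℕ) (W : Fin m → Subrepresentation ρ),
      DirectSum.IsInternal (fun i => (W i).toSubmodule) ∧
      ∀ i, (W i).toRepresentation.IsIrreducible := by
  obtain ⟨s, hind, htop, hs⟩ :=
    IsSemisimpleModule.exists_sSupIndep_sSup_simples_eq_top (MonoidAlgebra ℂ G) ρ.asModule
  have hfin : Finite s := by
    have : IsNoetherian (MonoidAlgebra ℂ G) ρ.asModule := isNoetherian_of_tower ℂ inferInstance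
    exact WellFoundedGT.finite_of_sSupIndep hind
  let e := Finite.equivFin s
  let N : Fin (Nat.card s) → Submodule (MonoidAlgebra ℂ G) ρ.asModule := fun i => (e.symm i).1
  have hN : DirectSum.IsInternal N := by
    apply DirectSum.isInternal_submodule_of_iSupIndep_of_iSup_eq_top
    · exact ((sSupIndep_iff _).mp hind).comp e.symm.injective
    · rw [← htop, sSup_eq_iSup']
      exact e.symm.iSup_comp (g := fun m : s => m.1)
  refine ⟨Nat.card s, fun i => Subrepresentation.ofSubmodule' (N i), hN, fun i => ?_⟩
  have hi : IsSimpleModule (MonoidAlgebra ℂ G) (N i) := hs _ (e.symm i).2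
  rw [irreducible_iff_isSimpleModule_asModule]
  -- `N i` has two `ℂ[G]`-module structures; they agree on the elements of `G`, hence everywhere.
  let σ := (Subrepresentation.ofSubmodule' (N i)).toRepresentation
  let f : σ.asModule →ₗ[MonoidAlgebra ℂ G] N i :=
    { toFun := fun x => x
      map_add' := fun _ _ => rfl
      map_smul' := fun r x => by
        induction r using MonoidAlgebra.induction_linear with
        | zero => exact (zero_smul _ x).trans (zero_smul _ (show N i from x)).symm
        | add r s hr hs =>
          exact (add_smul r s x).trans ((congrArg₂ (fun a b : N i => a + b) hr hs).trans
            (add_smul r s (show N i from x)).symm)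
        | single g a =>
          refine Subtype.ext ?_
          rw [single_smul]
          exact (single_smul ρ a g _).symm }
  exact IsSimpleModule.congr (LinearEquiv.ofBijective f ⟨fun _ _ h => h, fun x => ⟨x, rfl⟩⟩)

/-- The projections of an internal direct sum of subrepresentations onto its summands commute with
the group action. -/
theorem exists_projections {G : Type u} [Group G] {V : Type v} [AddCommGroup V] [Module ℂ V]
    {ρ : Representation ℂ G V} {m : ℕ} {W : Fin m → Subrepresentation ρ}
    (hW : DirectSum.IsInternal (fun i => (W i).toSubmodule)) :
    ∃ p : Fin m → ρ.IntertwiningMap ρ,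
      (∀ i v, p i v ∈ (W i).toSubmodule) ∧
      (∀ i, ∀ v ∈ (W i).toSubmodule, p i v = v) ∧
      (∀ i j, i ≠ j → ∀ v ∈ (W j).toSubmodule, p i v = 0) ∧
      ∀ v, ∑ i, p i v = v := by
  let e := LinearEquiv.ofBijective (DirectSum.coeLinearMap fun i => (W i).toSubmodule) hW
  let q : Fin m → V →ₗ[ℂ] V := fun i =>
    (W i).toSubmodule.subtype ∘ₗ DirectSum.component ℂ (Fin m) _ i ∘ₗ e.symm.toLinearMap
  have hsymm : ∀ i, ∀ v (hv : v ∈ (W i).toSubmodule),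
      e.symm v = DirectSum.lof ℂ (Fin m) (fun i => ↥(W i).toSubmodule) i ⟨v, hv⟩ := by
    intro i v hv
    rw [LinearEquiv.symm_apply_eq]
    exact (DirectSum.coeLinearMap_lof (fun i => (W i).toSubmodule) i ⟨v, hv⟩).symm
  have hself : ∀ i, ∀ v ∈ (W i).toSubmodule, q i v = v := by
    intro i v hv
    simp [q, hsymm i v hv, DirectSum.component.lof_self]
  have hother : ∀ i j, i ≠ j → ∀ v ∈ (W j).toSubmodule, q i v = 0 := by
    intro i j hij v hv
    simp [q, hsymm j v hv, DirectSum.component.of, hij.symm]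
  have hind : ∀ v, v ∈ ⨆ i, (W i).toSubmodule := fun v => by
    rw [hW.submodule_iSup_eq_top]; trivial
  refine ⟨fun i => (q i).intertwiningMap_of_isIntertwiningMap ρ ρ fun g v => ?_,
    fun i v => Subtype.prop _, hself, hother, fun v => ?_⟩
  · induction hind v using Submodule.iSup_induction' with
    | mem j v hv =>
      have hgv := (W j).apply_mem_toSubmodule g hv
      by_cases hij : i = j
      · subst hij
        rw [hself i _ hgv, hself i _ hv]
      · rw [hother i j hij _ hgv, hother i j hij _ hv, map_zero]
    | zero => simp
    | add v w _ _ hv hw => simp only [map_add, hv, hw]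
  · change ∑ i, q i v = v
    induction hind v using Submodule.iSup_induction' with
    | mem j v hv =>
      rw [Finset.sum_eq_single j (fun i _ hij => hother i j hij v hv) (by simp), hself j v hv]
    | zero => simp
    | add v w _ _ hv hw => simp only [map_add, Finset.sum_add_distrib, hv, hw]

/-- A representation whose intertwining algebra is commutative is multiplicity-free: an isomorphism
between two different irreducible summands would not commute with the projections. -/
theorem isMultiplicityFree_of_commute {G : Type u} [Group G] [Finite G] {V : Type v}
    [AddCommGroup V] [Module ℂ V] [FiniteDimensional ℂ V] (ρ : Representation ℂ G V)
    (hcomm : ∀ f g : ρ.IntertwiningMap ρ, f * g = g * f) : ρ.IsMultiplicityFree := by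
  obtain ⟨m, W, hW, hirr⟩ := exists_isInternal_isIrreducible ρ
  obtain ⟨p, hp, hself, hother, -⟩ := exists_projections hW
  refine ⟨m, W, hW, hirr, fun i j hij => ⟨fun E => ?_⟩⟩
  -- `T` carries `W i` onto `W j` and kills the other summands; it does not commute with `p i`.
  let T : ρ.IntertwiningMap ρ :=
    ((W j).toSubmodule.subtype ∘ₗ E.toLinearEquiv.toLinearMap ∘ₗ
      (p i).toLinearMap.codRestrict (W i).toSubmodule (hp i)).intertwiningMap_of_isIntertwiningMap
      ρ ρ fun g v => by
        have h1 : (p i).toLinearMap.codRestrict (W i).toSubmodule (hp i) (ρ g v) =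
            (W i).toRepresentation g ((p i).toLinearMap.codRestrict (W i).toSubmodule (hp i) v) :=
          Subtype.ext ((p i).isIntertwining _ _ g v)
        have h2 := E.toIntertwiningMap.isIntertwining _ _ g
          ((p i).toLinearMap.codRestrict (W i).toSubmodule (hp i) v)
        simp only [LinearMap.comp_apply, h1]
        exact congrArg Subtype.val h2
  have hT : ∀ v (hv : v ∈ (W i).toSubmodule), T v = (E ⟨v, hv⟩ : V) := by
    intro v hv
    change ((E _ : (W j).toSubmodule) : V) = _
    congr 2
    exact Subtype.ext (hself i v hv)
  have := (hirr i).nontrivial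
  obtain ⟨x, hx⟩ := exists_ne (0 : (W i).toSubmodule)
  apply hx
  have h0 : T x = 0 := by
    have h := congrArg (fun f : ρ.IntertwiningMap ρ => f x) (hcomm T (p i))
    simp only [IntertwiningMap.mul_apply] at h
    rw [hself i x x.2, hother i j hij _ (show T x ∈ (W j).toSubmodule from Subtype.prop _)] at h
    exact h
  rw [hT x x.2] at h0
  exact E.toLinearEquiv.map_eq_zero_iff.mp (Subtype.ext h0)

/-- If `ρ` is multiplicity-free and `W^τ ≃ W` for all its irreducible subrepresentations `W`, then
every intertwining operator is self-adjoint for every bilinear form with respect to which `ρ(τ(g))`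
is the adjoint of `ρ(g)`. Indeed, by Schur's lemma such operators are scalar on the irreducible
summands, and these summands are mutually orthogonal. -/
theorem IsMultiplicityFree.form_intertwiningMap_comm {G : Type u} [Group G] {V : Type v}
    [AddCommGroup V] [Module ℂ V] [FiniteDimensional ℂ V] {ρ : Representation ℂ G V}
    (hρ : ρ.IsMultiplicityFree) (τ : InvolutoryAntiAut G)
    (hτ : ∀ W : Subrepresentation ρ, W.toRepresentation.IsIrreducible →
      Nonempty ((W.toRepresentation.tauConj τ).Equiv W.toRepresentation))
    (β : V →ₗ[ℂ] Module.Dual ℂ V) (hβ : ∀ g v w, β (ρ g v) w = β v (ρ (τ g) w))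
    (φ : ρ.IntertwiningMap ρ) (v w : V) : β (φ v) w = β v (φ w) := by
  obtain ⟨m, W, hW, hirr, hne⟩ := hρ
  obtain ⟨p, hp, hself, hother, hsum⟩ := exists_projections hW
  have hoff : ∀ i j, i ≠ j → ∀ x ∈ (W i).toSubmodule, p j (φ x) = 0 := by
    intro i j hij x hx
    have := hirr i
    have := hirr j
    have := hne i j hij
    let F : (W i).toRepresentation.IntertwiningMap (W j).toRepresentation :=
      ((((p j).toLinearMap ∘ₗ φ.toLinearMap).codRestrict (W j).toSubmodule fun y => hp j _) ∘ₗ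
        (W i).toSubmodule.subtype).intertwiningMap_of_isIntertwiningMap _ _ fun g y => by
          refine Subtype.ext ?_
          change p j (φ (ρ g y)) = ρ g (p j (φ y))
          rw [φ.isIntertwining, (p j).isIntertwining]
    have hF : F = 0 := Subsingleton.elim _ _
    exact congrArg Subtype.val (congrArg (fun f => f ⟨x, hx⟩) hF)
  have hscalar : ∀ i, ∃ c : ℂ, ∀ x ∈ (W i).toSubmodule, φ x = c • x := by
    intro i
    have := hirr i
    let F : (W i).toRepresentation.IntertwiningMap (W i).toRepresentation :=
      ((((p i).toLinearMap ∘ₗ φ.toLinearMap).codRestrict (W i).toSubmodule fun y => hp i _) ∘ₗ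
        (W i).toSubmodule.subtype).intertwiningMap_of_isIntertwiningMap _ _ fun g y => by
          refine Subtype.ext ?_
          change p i (φ (ρ g y)) = ρ g (p i (φ y))
          rw [φ.isIntertwining, (p i).isIntertwining]
    obtain ⟨c, hc⟩ := (IsIrreducible.algebraMap_intertwiningMap_bijective_of_isAlgClosed
      (ρ := (W i).toRepresentation)).2 F
    refine ⟨c, fun x hx => ?_⟩
    have h : c • x = p i (φ x) := congrArg Subtype.val (congrArg (fun f => f ⟨x, hx⟩) hc)
    rw [h, ← hsum (φ x), Finset.sum_eq_single i (fun j _ hj => hoff i j hj.symm x hx) (by simp),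
      hself i _ (hp i _)]
  -- On `W i × W j` the form is an intertwining map `W i → (W j)^τ ≃ W j`.
  have horth : ∀ i j, i ≠ j → ∀ x ∈ (W i).toSubmodule, ∀ y ∈ (W j).toSubmodule, β x y = 0 := by
    intro i j hij x hx y hy
    have := hirr i
    have := hirr j
    have := hne i j hij
    obtain ⟨E⟩ := hτ (W j) (hirr j)
    let B : (W i).toRepresentation.IntertwiningMap ((W j).toRepresentation.tauConj τ) :=
      ((W j).toSubmodule.subtype.dualMap ∘ₗ β ∘ₗ
        (W i).toSubmodule.subtype).intertwiningMap_of_isIntertwiningMap _ _ fun g y => by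
          ext z
          exact hβ g y z
    have hB : E.toIntertwiningMap.comp B = 0 := Subsingleton.elim _ _
    have h0 : E (B ⟨x, hx⟩) = 0 := congrArg (fun f => f ⟨x, hx⟩) hB
    have h1 : B ⟨x, hx⟩ = 0 := E.toLinearEquiv.map_eq_zero_iff.mp h0
    exact congrArg (fun f => f ⟨y, hy⟩) h1
  have hpair : ∀ i j, ∀ x ∈ (W i).toSubmodule, ∀ y ∈ (W j).toSubmodule,
      β (φ x) y = β x (φ y) := by
    intro i j x hx y hy
    obtain ⟨c, hc⟩ := hscalar i
    obtain ⟨d, hd⟩ := hscalar j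
    rw [hc x hx, hd y hy]
    simp only [map_smul, LinearMap.smul_apply]
    by_cases hij : i = j
    · subst hij
      rw [← map_smul, ← hc y hy, hd y hy, map_smul]
    · rw [horth i j hij x hx y hy, smul_zero, smul_zero]
  rw [← hsum v, ← hsum w]
  simp only [map_sum, LinearMap.sum_apply]
  exact Finset.sum_congr rfl fun j _ => Finset.sum_congr rfl fun i _ =>
    hpair _ _ _ (hp _ _) _ (hp _ _)

/-! ### Equivalence of a representation with its conjugate -/

/-- If `τ` preserves conjugacy classes then `ρ^τ` and `ρ` have the same character, and so they are
equivalent. -/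
theorem nonempty_tauConj_equiv {G : Type u} [Group G] [Finite G] {V : Type v}
    [AddCommGroup V] [Module ℂ V] [FiniteDimensional ℂ V] (ρ : Representation ℂ G V)
    (hρ : ρ.IsIrreducible) (τ : InvolutoryAntiAut G) (hτ : ∀ g, IsConj g (τ g)) :
    Nonempty ((ρ.tauConj τ).Equiv ρ) := by
  have := Fintype.ofFinite G
  have : Invertible (Nat.card G : ℂ) := invertibleOfNonzero (by exact_mod_cast Nat.card_pos.ne')
  have hchar : (ρ.tauConj τ).character = ρ.character := by
    ext g
    obtain ⟨k, hk⟩ := isConj_iff.mp (hτ g)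
    calc (ρ.tauConj τ).character g = ρ.character (τ g) := LinearMap.trace_transpose' (ρ (τ g))
      _ = ρ.character g := by rw [← hk, char_conj]
  -- Equal characters give `dim Hom_G(ρ^τ, ρ) = dim Hom_G(ρ, ρ) = 1`.
  have hfin : Module.finrank ℂ ((ρ.tauConj τ).IntertwiningMap ρ) = 1 := by
    have h := card_inv_mul_sum_char_mul_char_eq_finrank (ρ.tauConj τ) ρ
    rw [hchar, card_inv_mul_sum_char_mul_char_eq_finrank ρ ρ,
      IsIrreducible.finrank_intertwiningMap_self] at h
    exact_mod_cast h.symm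
  have : Nontrivial ((ρ.tauConj τ).IntertwiningMap ρ) :=
    Module.nontrivial_of_finrank_pos (R := ℂ) (by omega)
  obtain ⟨f, hf⟩ := exists_ne (0 : (ρ.tauConj τ).IntertwiningMap ρ)
  have hsurj := (IsIrreducible.surjective_or_eq_zero f).resolve_right hf
  exact ⟨f.ofBijective ⟨(LinearMap.injective_iff_surjective_of_finrank_eq_finrank
    (f := f.toLinearMap) Subspace.dual_finrank_eq).mpr hsurj, hsurj⟩⟩

/-! ### Sums over simultaneous conjugates and the form on a tensor product -/

/-- The operator `∑ k, ρ₁(k g k⁻¹) ⊗ ρ₂(k h k⁻¹)` on `V₁ ⊗ V₂`: the action of the sum, with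
multiplicities, of the simultaneous conjugates of `(g, h)` in the group algebra of `G × G`. -/
noncomputable def conjugationSum {G : Type u} [Group G] [Fintype G] {V₁ V₂ : Type v}
    [AddCommGroup V₁] [Module ℂ V₁] [AddCommGroup V₂] [Module ℂ V₂]
    (ρ₁ : Representation ℂ G V₁) (ρ₂ : Representation ℂ G V₂) (g h : G) :
    Module.End ℂ (V₁ ⊗[ℂ] V₂) :=
  ∑ k : G, TensorProduct.map (ρ₁ (k * g * k⁻¹)) (ρ₂ (k * h * k⁻¹))

section

variable {G : Type u} [Group G] {V₁ V₂ : Type v}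
    [AddCommGroup V₁] [Module ℂ V₁] [AddCommGroup V₂] [Module ℂ V₂]
    (ρ₁ : Representation ℂ G V₁) (ρ₂ : Representation ℂ G V₂)

theorem conjugationSum_conj [Fintype G] (a g h : G) :
    conjugationSum ρ₁ ρ₂ (a * g * a⁻¹) (a * h * a⁻¹) = conjugationSum ρ₁ ρ₂ g h := by
  refine Fintype.sum_equiv (Equiv.mulRight a) _ _ fun k => ?_
  simp only [Equiv.coe_mulRight, mul_inv_rev, mul_assoc]

theorem sum_tprod_mul_map_mul_tprod [Fintype G] (g h : G) :
    ∑ k : G, ρ₁.tprod ρ₂ k * TensorProduct.map (ρ₁ g) (ρ₂ h) * ρ₁.tprod ρ₂ k⁻¹ =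
      conjugationSum ρ₁ ρ₂ g h := by
  refine Finset.sum_congr rfl fun k _ => ?_
  simp only [tprod_apply, ← TensorProduct.map_mul, ← map_mul]

theorem conjugationSum_mul_tprod [Fintype G] (a g h : G) :
    conjugationSum ρ₁ ρ₂ g h * ρ₁.tprod ρ₂ a = ρ₁.tprod ρ₂ a * conjugationSum ρ₁ ρ₂ g h := by
  simp only [conjugationSum, Finset.sum_mul, Finset.mul_sum, tprod_apply, ← TensorProduct.map_mul,
    ← map_mul]
  refine Fintype.sum_equiv (Equiv.mulLeft a⁻¹) _ _ fun k => ?_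
  simp [mul_assoc]

/-- Isomorphisms `ρᵢ^τ ≃ ρᵢ` amount to nondegenerate bilinear forms on `Vᵢ` for which `ρᵢ(τ(g))` is
the adjoint of `ρᵢ(g)`. Their product is such a form on `V₁ ⊗ V₂` for the action of `G × G`. The form
is encoded as an isomorphism of `V₁ ⊗ V₂` with its dual. -/
theorem exists_form_of_tauConj_equiv [FiniteDimensional ℂ V₁] [FiniteDimensional ℂ V₂]
    {τ : InvolutoryAntiAut G}
    (h₁ : Nonempty ((ρ₁.tauConj τ).Equiv ρ₁)) (h₂ : Nonempty ((ρ₂.tauConj τ).Equiv ρ₂)) :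
    ∃ β : V₁ ⊗[ℂ] V₂ ≃ₗ[ℂ] Module.Dual ℂ (V₁ ⊗[ℂ] V₂), ∀ g h v w,
      β (TensorProduct.map (ρ₁ g) (ρ₂ h) v) w =
        β v (TensorProduct.map (ρ₁ (τ g)) (ρ₂ (τ h)) w) := by
  obtain ⟨E₁⟩ := h₁
  obtain ⟨E₂⟩ := h₂
  let L₁ := E₁.symm
  let L₂ := E₂.symm
  have hL₁ : ∀ g v w, L₁ (ρ₁ g v) w = L₁ v (ρ₁ (τ g) w) := fun g v w =>
    congrArg (fun f : Module.Dual ℂ V₁ => f w) (L₁.toIntertwiningMap.isIntertwining _ _ g v)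
  have hL₂ : ∀ g v w, L₂ (ρ₂ g v) w = L₂ v (ρ₂ (τ g) w) := fun g v w =>
    congrArg (fun f : Module.Dual ℂ V₂ => f w) (L₂.toIntertwiningMap.isIntertwining _ _ g v)
  let β := (TensorProduct.congr L₁.toLinearEquiv L₂.toLinearEquiv).trans
    (TensorProduct.dualDistribEquiv ℂ V₁ V₂)
  have hβ : ∀ v₁ v₂ w₁ w₂, β (v₁ ⊗ₜ v₂) (w₁ ⊗ₜ w₂) = L₁ v₁ w₁ * L₂ v₂ w₂ := fun _ _ _ _ => rfl
  refine ⟨β, fun g h v w => ?_⟩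
  induction v with
  | zero => simp
  | add x y hx hy => simp only [map_add, LinearMap.add_apply, hx, hy]
  | tmul v₁ v₂ =>
    induction w with
    | zero => simp
    | add x y hx hy => simp only [map_add, hx, hy]
    | tmul w₁ w₂ => simp only [TensorProduct.map_tmul, hβ, hL₁, hL₂]

theorem form_conjugationSum [Fintype G] {τ : InvolutoryAntiAut G}
    {β : V₁ ⊗[ℂ] V₂ →ₗ[ℂ] Module.Dual ℂ (V₁ ⊗[ℂ] V₂)}
    (hβ : ∀ g h v w, β (TensorProduct.map (ρ₁ g) (ρ₂ h) v) w =
        β v (TensorProduct.map (ρ₁ (τ g)) (ρ₂ (τ h)) w)) (g h : G) (v w : V₁ ⊗[ℂ] V₂) :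
    β (conjugationSum ρ₁ ρ₂ g h v) w = β v (conjugationSum ρ₁ ρ₂ (τ g) (τ h) w) := by
  have hinv : ∀ k, τ k⁻¹ = (τ k)⁻¹ := fun k =>
    eq_inv_of_mul_eq_one_left (by rw [← τ.map_mul, mul_inv_cancel, τ.map_one])
  -- `τ (k g k⁻¹)` is the conjugate of `τ g` by `(τ k)⁻¹`, so the sum is reindexed by `k ↦ (τ k)⁻¹`.
  let e : G ≃ G := (⟨τ, τ, τ.apply_apply, τ.apply_apply⟩ : G ≃ G).trans (Equiv.inv G)
  simp only [conjugationSum, LinearMap.sum_apply, map_sum, hβ]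
  refine Fintype.sum_equiv e _ _ fun k => ?_
  change _ = β v (TensorProduct.map (ρ₁ ((τ k)⁻¹ * τ g * (τ k)⁻¹⁻¹))
    (ρ₂ ((τ k)⁻¹ * τ h * (τ k)⁻¹⁻¹)) w)
  simp only [τ.map_mul, hinv, inv_inv, mul_assoc]

end

/-- Gelfand's trick: the form on `V₁ ⊗ V₂` makes every intertwining operator of `ρ₁ ⊗ ρ₂`
self-adjoint, which forces these operators to commute with each other. -/
theorem isMultiplicityFree_tprod {G : Type u} [Group G] [Finite G] {V₁ V₂ : Type v}
    [AddCommGroup V₁] [Module ℂ V₁] [FiniteDimensional ℂ V₁]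
    [AddCommGroup V₂] [Module ℂ V₂] [FiniteDimensional ℂ V₂]
    (ρ₁ : Representation ℂ G V₁) (ρ₂ : Representation ℂ G V₂)
    (h₁ : ρ₁.IsIrreducible) (h₂ : ρ₂.IsIrreducible) (τ : InvolutoryAntiAut G)
    (hτ : ∀ g h : G, ∃ k : G, τ g = k * g * k⁻¹ ∧ τ h = k * h * k⁻¹) :
    (ρ₁.tprod ρ₂).IsMultiplicityFree := by
  have := Fintype.ofFinite G
  have hconj : ∀ g, IsConj g (τ g) := fun g => by
    obtain ⟨k, hk, -⟩ := hτ g g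
    exact isConj_iff.mpr ⟨k, hk.symm⟩
  obtain ⟨β, hβ⟩ := exists_form_of_tauConj_equiv ρ₁ ρ₂
    (nonempty_tauConj_equiv ρ₁ h₁ τ hconj) (nonempty_tauConj_equiv ρ₂ h₂ τ hconj)
  -- Averages over `G` of operators `ρ₁(g) ⊗ ρ₂(h)` are self-adjoint, and these operators span.
  have havg : ∀ (A : Module.End ℂ (V₁ ⊗[ℂ] V₂)) v w,
      β ((∑ k : G, ρ₁.tprod ρ₂ k * A * ρ₁.tprod ρ₂ k⁻¹) v) w =
        β v ((∑ k : G, ρ₁.tprod ρ₂ k * A * ρ₁.tprod ρ₂ k⁻¹) w) := by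
    intro A
    have hA : A ∈ Submodule.span ℂ
        (Set.range fun x : G × G => TensorProduct.map (ρ₁ x.1) (ρ₂ x.2)) := by
      rw [span_range_map_eq_top ρ₁ ρ₂ h₁ h₂]
      trivial
    induction hA using Submodule.span_induction with
    | mem A hA =>
      obtain ⟨⟨g, h⟩, rfl⟩ := hA
      intro v w
      obtain ⟨k, hg, hh⟩ := hτ g h
      rw [sum_tprod_mul_map_mul_tprod]
      refine (form_conjugationSum ρ₁ ρ₂ (β := β.toLinearMap) hβ g h v w).trans ?_
      rw [hg, hh, conjugationSum_conj]
      rfl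
    | zero => simp
    | add A B _ _ hA hB =>
      intro v w
      simp only [mul_add, add_mul, Finset.sum_add_distrib, LinearMap.add_apply, map_add, hA, hB]
    | smul c A _ hA =>
      intro v w
      simp only [mul_smul_comm, smul_mul_assoc, ← Finset.smul_sum, LinearMap.smul_apply, map_smul,
        hA]
  -- An intertwining operator is a multiple of its own average.
  have hself : ∀ (f : (ρ₁.tprod ρ₂).IntertwiningMap (ρ₁.tprod ρ₂)) v w,
      β (f v) w = β v (f w) := by
    intro f v w
    have hf : ∑ k : G, ρ₁.tprod ρ₂ k * f.toLinearMap * ρ₁.tprod ρ₂ k⁻¹ =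
        (Fintype.card G : ℂ) • f.toLinearMap := by
      rw [Finset.sum_congr rfl (g := fun _ => f.toLinearMap)]
      · simp [Nat.cast_smul_eq_nsmul]
      · intro k _
        have h : f.toLinearMap * ρ₁.tprod ρ₂ k⁻¹ = ρ₁.tprod ρ₂ k⁻¹ * f.toLinearMap :=
          f.isIntertwining' k⁻¹
        rw [mul_assoc, h, ← mul_assoc, ← map_mul, mul_inv_cancel, map_one, one_mul]
    have h := havg f.toLinearMap v w
    rw [hf] at h
    simp only [LinearMap.smul_apply, map_smul] at h
    exact smul_right_injective ℂ
      (show (Fintype.card G : ℂ) ≠ 0 by exact_mod_cast Fintype.card_ne_zero) h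
  -- As `f`, `g` and `f * g` are self-adjoint, `f * g` equals its adjoint, which is `g * f`.
  refine isMultiplicityFree_of_commute _ fun f g => DFunLike.ext _ _ fun v => ?_
  refine β.injective (LinearMap.ext fun w => ?_)
  change β (f (g v)) w = β (g (f v)) w
  rw [hself g (f v), hself f v]
  exact hself (f * g) v w

/-- In a `τ`-simply reducible group, the sum over the conjugates of `(τ(g), τ(h))` acts on `V₁ ⊗ V₂`
in the same way as the sum over those of `(g, h)`: the former operator is self-adjoint, being
intertwining, and it is also the adjoint of the latter. -/
theorem conjugationSum_tau_eq {G : Type u} [Group G] [Fintype G] {V₁ V₂ : Type v}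
    [AddCommGroup V₁] [Module ℂ V₁] [FiniteDimensional ℂ V₁]
    [AddCommGroup V₂] [Module ℂ V₂] [FiniteDimensional ℂ V₂]
    (ρ₁ : Representation ℂ G V₁) (ρ₂ : Representation ℂ G V₂) (τ : InvolutoryAntiAut G)
    (hG : IsTauSimplyReducible.{u, v} G τ)
    (h₁ : ρ₁.IsIrreducible) (h₂ : ρ₂.IsIrreducible) (g h : G) :
    conjugationSum ρ₁ ρ₂ (τ g) (τ h) = conjugationSum ρ₁ ρ₂ g h := by
  obtain ⟨β, hβ⟩ := exists_form_of_tauConj_equiv ρ₁ ρ₂ (hG.2 V₁ ρ₁ h₁) (hG.2 V₂ ρ₂ h₂)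
  let φ : (ρ₁.tprod ρ₂).IntertwiningMap (ρ₁.tprod ρ₂) :=
    ⟨conjugationSum ρ₁ ρ₂ (τ g) (τ h), fun a => conjugationSum_mul_tprod ρ₁ ρ₂ a (τ g) (τ h)⟩
  refine LinearMap.ext fun v => β.injective (LinearMap.ext fun w => ?_)
  have h1 := form_conjugationSum ρ₁ ρ₂ (β := β.toLinearMap) hβ g h v w
  have h2 := (hG.1 V₁ V₂ ρ₁ ρ₂ h₁ h₂).form_intertwiningMap_comm τ (fun W hW => hG.2 _ _ hW)
    β.toLinearMap (fun a => hβ a a) φ v w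
  exact h2.trans h1.symm

/-! ### Faithfulness of the regular representation -/

/-- An equality of conjugation sums on `V ⊗ V` may be checked on tensor products of irreducible
subrepresentations of `V`, since these span `V ⊗ V`. -/
theorem conjugationSum_eq_of_subrepresentation {G : Type u} [Group G] [Fintype G] {V : Type v}
    [AddCommGroup V] [Module ℂ V] [FiniteDimensional ℂ V]
    (ρ : Representation ℂ G V) {g h g' h' : G}
    (H : ∀ W₁ W₂ : Subrepresentation ρ, W₁.toRepresentation.IsIrreducible →
      W₂.toRepresentation.IsIrreducible →
      conjugationSum W₁.toRepresentation W₂.toRepresentation g h =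
        conjugationSum W₁.toRepresentation W₂.toRepresentation g' h') :
    conjugationSum ρ ρ g h = conjugationSum ρ ρ g' h' := by
  obtain ⟨m, W, hW, hirr⟩ := exists_isInternal_isIrreducible ρ
  have hmem : ∀ v, v ∈ ⨆ i, (W i).toSubmodule := fun v => by
    rw [hW.submodule_iSup_eq_top]
    trivial
  refine TensorProduct.ext' fun v w => ?_
  induction hmem v using Submodule.iSup_induction' with
  | zero => simp
  | add x y _ _ hx hy => simp only [TensorProduct.add_tmul, map_add, hx, hy]
  | mem i v hv =>
    induction hmem w using Submodule.iSup_induction' with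
    | zero => simp
    | add x y _ _ hx hy => simp only [TensorProduct.tmul_add, map_add, hx, hy]
    | mem j w hw =>
      have hmap : ∀ a b : G,
          TensorProduct.map (W i).toSubmodule.subtype (W j).toSubmodule.subtype
            (conjugationSum (W i).toRepresentation (W j).toRepresentation a b
              (⟨v, hv⟩ ⊗ₜ ⟨w, hw⟩)) = conjugationSum ρ ρ a b (v ⊗ₜ w) := by
        intro a b
        simp only [conjugationSum, LinearMap.sum_apply, map_sum, TensorProduct.map_tmul]
        rfl
      rw [← hmap, ← hmap, H (W i) (W j) (hirr i) (hirr j)]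

/-- The left regular representation of `G`, transported along a bijection `e : G ≃ S`. The type `S`
serves to move the representation to another universe. -/
noncomputable def regularOfEquiv {G : Type u} [Group G] {S : Type w} (e : G ≃ S) :
    Representation ℂ G (S →₀ ℂ) where
  toFun g := Finsupp.lmapDomain ℂ ℂ fun s => e (g * e.symm s)
  map_one' := by
    have h : (fun s => e (1 * e.symm s)) = id := funext fun s => by simp
    rw [h]
    exact Finsupp.lmapDomain_id ℂ ℂ
  map_mul' a b := by
    rw [Module.End.mul_eq_comp, ← Finsupp.lmapDomain_comp]
    congr 1
    funext s
    simp [mul_assoc]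

theorem regularOfEquiv_single {G : Type u} [Group G] {S : Type w} (e : G ≃ S) (a b : G) :
    regularOfEquiv e a (Finsupp.single (e b) 1) = Finsupp.single (e (a * b)) 1 := by
  change Finsupp.mapDomain _ _ = _
  rw [Finsupp.mapDomain_single, e.symm_apply_apply]

theorem conjugationSum_regularOfEquiv_coeff {G : Type u} [Group G] [Fintype G] [DecidableEq G]
    {S : Type w} (e : G ≃ S) (a b c d : G) :
    finsuppTensorFinsupp' ℂ S S
      (conjugationSum (regularOfEquiv e) (regularOfEquiv e) a b
        (Finsupp.single (e 1) 1 ⊗ₜ Finsupp.single (e 1) 1)) (e c, e d) =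
      ∑ k : G, if k * a * k⁻¹ = c ∧ k * b * k⁻¹ = d then (1 : ℂ) else 0 := by
  classical
  rw [conjugationSum, LinearMap.sum_apply, map_sum, Finsupp.finsetSum_apply]
  refine Finset.sum_congr rfl fun k _ => ?_
  rw [TensorProduct.map_tmul, regularOfEquiv_single, regularOfEquiv_single,
    finsuppTensorFinsupp'_single_tmul_single, Finsupp.single_apply]
  simp only [mul_one, Prod.mk.injEq, EmbeddingLike.apply_eq_iff_eq]

/-- The group algebra of `G × G` acts faithfully on the tensor square of the regular representation,
so the conjugation sums determine the simultaneous conjugacy class. -/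
theorem exists_conj_of_conjugationSum_regularOfEquiv_eq {G : Type u} [Group G] [Fintype G]
    {S : Type w} (e : G ≃ S) {g h g' h' : G}
    (H : conjugationSum (regularOfEquiv e) (regularOfEquiv e) g h =
      conjugationSum (regularOfEquiv e) (regularOfEquiv e) g' h') :
    ∃ k : G, g' = k * g * k⁻¹ ∧ h' = k * h * k⁻¹ := by
  classical
  -- Compare coefficients at `(g', h')`: on the right, `k = 1` already contributes.
  have hcount := conjugationSum_regularOfEquiv_coeff e g' h' g' h'
  rw [← H, conjugationSum_regularOfEquiv_coeff] at hcount
  by_contra! hne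
  rw [Finset.sum_eq_zero fun k _ => if_neg fun hk => hne k hk.1.symm hk.2.symm,
    Finset.sum_boole] at hcount
  have hcard : (Finset.univ.filter fun k : G =>
      k * g' * k⁻¹ = g' ∧ k * h' * k⁻¹ = h').card = 0 := by
    exact_mod_cast hcount.symm
  rw [Finset.card_eq_zero, Finset.filter_eq_empty_iff] at hcard
  exact hcard (Finset.mem_univ 1) (by simp)

end Representation

/-! ### The criterion -/

open Representation in
/-- The pairs `(g, h)` and `(τ(g), τ(h))` have the same conjugation sum on every tensor product of
irreducible representations, so they are simultaneously conjugate. -/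
theorem IsTauSimplyReducible.exists_conj {G : Type u} [Group G] [Finite G]
    {τ : InvolutoryAntiAut G}
    (hG : IsTauSimplyReducible.{u, w} G τ) (g h : G) :
    ∃ k : G, τ g = k * g * k⁻¹ ∧ τ h = k * h * k⁻¹ := by
  have := Fintype.ofFinite G
  have : Finite (Shrink.{w} G) := Finite.of_equiv G (equivShrink.{w} G)
  -- `Shrink` moves the regular representation into the universe of the hypothesis.
  let e : G ≃ Shrink.{w} G := equivShrink.{w} G
  refine exists_conj_of_conjugationSum_regularOfEquiv_eq e
    (conjugationSum_eq_of_subrepresentation (regularOfEquiv e) ?_)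
  intro W₁ W₂ h₁ h₂
  have hτ := conjugationSum_tau_eq (V₁ := W₁.toSubmodule) (V₂ := W₂.toSubmodule)
    W₁.toRepresentation W₂.toRepresentation τ hG h₁ h₂ g h
  exact hτ.symm

/-- A finite group is `τ`-simply reducible if and only if every pair of its elements is simultaneously
conjugate to its image under `τ`. -/
theorem isTauSimplyReducible_iff {G : Type u} [Group G] [Finite G] (τ : InvolutoryAntiAut G) :
    IsTauSimplyReducible.{u, w} G τ ↔
      ∀ g h : G, ∃ k : G, τ g = k * g * k⁻¹ ∧ τ h = k * h * k⁻¹ := by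
  refine ⟨fun hG => hG.exists_conj, fun hτ => ⟨?_, ?_⟩⟩
  · intro V₁ V₂ _ _ _ _ _ _ ρ₁ ρ₂ h₁ h₂
    exact Representation.isMultiplicityFree_tprod ρ₁ ρ₂ h₁ h₂ τ hτ
  · intro V _ _ _ ρ hρ
    refine ρ.nonempty_tauConj_equiv hρ τ fun g => ?_
    obtain ⟨k, hk, -⟩ := hτ g g
    exact isConj_iff.mpr ⟨k, hk.symm⟩

theorem theorem5p3 {G : Type u} [Group G] [Finite G] :
    (∀ τ : InvolutoryAntiAut G,
      IsTauSimplyReducible.{u, w} G τ ↔ DiagonalDoubleCosetsInvariant G τ 3) ∧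
    (IsSimplyReducible.{u, w} G ↔
      DiagonalDoubleCosetsInvariant G (InvolutoryAntiAut.inversion G) 3) := by
  have main : ∀ τ : InvolutoryAntiAut G,
      IsTauSimplyReducible.{u, w} G τ ↔ DiagonalDoubleCosetsInvariant G τ 3 := fun τ =>
    (isTauSimplyReducible_iff τ).trans (diagonalDoubleCosetsInvariant_three_iff τ).symm
  -- By definition, the dual of `ρ` is `ρ^τ` for the inversion `τ`.
  exact ⟨main, main (InvolutoryAntiAut.inversion G)⟩
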